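/- Let $k\ge 2$ be an integer. Let $Z_k$ be the infinite graph with vertices $v_{i,j}$ and $w_{i,j}$ ($i\in\mathbb Z$, $1\le j\le k$), in which every $v_{i,j}$ is joined to every $w_{i,l}$ ($i\in\mathbb Z$, $1\le j,l\le k$) and every $w_{i,j}$ is joined to $v_{i+1,j}$ ($i\in\mathbb Z$, $1\le j\le k$), and let $W_{n,k}$ be the finite graph defined in the same way with the index $i$ taken modulo $n$. Then $Z_k$ is an infinite, vertex-transitive, $(k+1)$-regular graph, and it is the local limit of the graphs $W_{n,k}$ as $n\to\infty$: for every $r$ and all sufficiently large $n$, every ball of radius $r$ in $W_{n,k}$ is isomorphic, as a graph rooted at its centre, to every ball of radius $r$ in $Z_k$. Let $A$ be the adjacency operator of $Z_k$, $(Af)(x)=\sum_{y\sim x}f(y)$, a bounded operator on $\ell^2(V(Z_k))$. Then $A$ is self-adjoint, and its spectrum is $$\sigma(Z_k)=\{-1,1\}\cup[k-1,k+1]\cup[-k-1,-k+1].$$ For a vertex $x$, let $\mu_x$ be the spectral measure of $A$ at the unit vector $\delta_x$, that is, the Borel measure on $\mathbb R$ with $\int f\,d\mu_x=\langle\delta_x,f(A)\delta_x\rangle$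 for all continuous compactly supported $f$. Then for every vertex $x$ $$\mu_x\big([k-1,k+1]\setminus\{1\}\big)=\mu_x\big([-k-1,-k+1]\setminus\{-1\}\big)=\frac1{2k},\qquad \mu_x(\{1\})=\mu_x(\{-1\})=\frac12-\frac1{2k}.$$ (Removing the points $\pm1$ from the intervals matters only for $k=2$, when they are end points of the intervals.) -/

import Mathlib

open scoped CompactlySupported ENNReal

noncomputable section

namespace SimpleGraph

/-! ### Vertex-transitivity and local limits -/

/-- Any vertex can be moved to any other by a graph automorphism. -/
def IsVertexTransitive {V : Type*} (G : SimpleGraph V) : Prop :=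
  ∀ u v : V, ∃ φ : G ≃g G, φ u = v

/-- The ball of radius `r` around `x`: all vertices at distance at most `r` from `x`. -/
def closedBall {V : Type*} (G : SimpleGraph V) (x : V) (r : ℕ) : Set V :=
  {y | G.edist x y ≤ r}

theorem self_mem_closedBall {V : Type*} (G : SimpleGraph V) (x : V) (r : ℕ) :
    x ∈ G.closedBall x r := by
  simp [closedBall]

/-- `H` is the local limit of the sequence `G n`: for each radius `r` and all large enough `n`,
each ball of radius `r` in `G n` is isomorphic, as a graph with a distinguished centre, to each
ball of radius `r` in `H`. -/
def IsLocalLimit {V : ℕ → Type*} {U : Type*} (G : ∀ n, SimpleGraph (V n))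
    (H : SimpleGraph U) : Prop :=
  ∀ r : ℕ, ∀ᶠ n in Filter.atTop, ∀ (x : V n) (z : U),
    ∃ φ : (G n).induce ((G n).closedBall x r) ≃g H.induce (H.closedBall z r),
      φ ⟨x, self_mem_closedBall _ x r⟩ = ⟨z, self_mem_closedBall _ z r⟩

/-! ### The adjacency operator of a graph of bounded degree -/

section AdjacencyOperator

variable {V : Type*} (G : SimpleGraph V) [G.LocallyFinite]

theorem sum_norm_sq_neighbor_sum_le (d : ℕ) (hd : ∀ v, G.degree v ≤ d)
    (f : lp (fun _ : V => ℂ) 2) (s : Finset V) :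
    ∑ v ∈ s, ‖∑ u ∈ G.neighborFinset v, f u‖ ^ (2 : ℝ≥0∞).toReal
      ≤ ((d : ℝ) * ‖f‖) ^ (2 : ℝ≥0∞).toReal := by
  classical
  have hf : ∀ T : Finset V, ∑ u ∈ T, ‖f u‖ ^ 2 ≤ ‖f‖ ^ 2 := fun T => by
    simpa using lp.sum_rpow_le_norm_rpow (p := 2) (by norm_num) f T
  simp only [ENNReal.toReal_ofNat, Real.rpow_ofNat]
  calc ∑ v ∈ s, ‖∑ u ∈ G.neighborFinset v, f u‖ ^ 2
      ≤ ∑ v ∈ s, (d : ℝ) * ∑ u ∈ G.neighborFinset v, ‖f u‖ ^ 2 := by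
        refine Finset.sum_le_sum fun v _ => ?_
        calc ‖∑ u ∈ G.neighborFinset v, f u‖ ^ 2
            ≤ (∑ u ∈ G.neighborFinset v, ‖f u‖) ^ 2 := by
              gcongr
              exact norm_sum_le _ _
          _ ≤ ((G.neighborFinset v).card : ℝ) * ∑ u ∈ G.neighborFinset v, ‖f u‖ ^ 2 :=
              sq_sum_le_card_mul_sum_sq
          _ ≤ (d : ℝ) * ∑ u ∈ G.neighborFinset v, ‖f u‖ ^ 2 := by
              gcongr
              exact hd v
    _ = (d : ℝ) * ∑ u ∈ s.biUnion (fun v => G.neighborFinset v),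
          ∑ v ∈ s with u ∈ G.neighborFinset v, ‖f u‖ ^ 2 := by
        rw [← Finset.mul_sum]
        congr 1
        refine Finset.sum_comm' fun v u => ?_
        simp only [Finset.mem_filter, Finset.mem_biUnion]
        exact ⟨fun h => ⟨h, v, h⟩, fun h => h.1⟩
    _ ≤ (d : ℝ) * ∑ u ∈ s.biUnion (fun v => G.neighborFinset v), (d : ℝ) * ‖f u‖ ^ 2 := by
        gcongr with u _
        rw [Finset.sum_const, nsmul_eq_mul]
        gcongr
        refine le_trans (Finset.card_le_card fun v hv => ?_) (hd u)
        simp only [Finset.mem_filter, mem_neighborFinset] at hv ⊢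
        exact hv.2.symm
    _ ≤ (d : ℝ) * ((d : ℝ) * ‖f‖ ^ 2) := by
        rw [← Finset.mul_sum]
        gcongr
        exact hf _
    _ = ((d : ℝ) * ‖f‖) ^ 2 := by ring

/-- The adjacency operator `(A f) v = ∑_{u ~ v} f u` on `ℓ²(V)`, for a graph all of whose degrees
are at most `d`. -/
def adjacencyOperator (d : ℕ) (hd : ∀ v, G.degree v ≤ d) :
    lp (fun _ : V => ℂ) 2 →L[ℂ] lp (fun _ : V => ℂ) 2 :=
  LinearMap.mkContinuous
    { toFun := fun f => ⟨fun v => ∑ u ∈ G.neighborFinset v, f u,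
        memℓp_gen' (sum_norm_sq_neighbor_sum_le G d hd f)⟩
      map_add' := fun f g => by
        ext v
        exact Finset.sum_add_distrib
      map_smul' := fun c f => by
        ext v
        exact (Finset.mul_sum _ _ _).symm }
    d
    (fun f => lp.norm_le_of_forall_sum_le (by norm_num) (by positivity)
      (sum_norm_sq_neighbor_sum_le G d hd f))

theorem adjacencyOperator_apply (d : ℕ) (hd : ∀ v, G.degree v ≤ d)
    (f : lp (fun _ : V => ℂ) 2) (v : V) :
    G.adjacencyOperator d hd f v = ∑ u ∈ G.neighborFinset v, f u := rfl

end AdjacencyOperator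

end SimpleGraph

/-! ### Spectral measures of bounded self-adjoint operators -/

section SpectralMeasure

variable {H : Type*} [NormedAddCommGroup H] [InnerProductSpace ℂ H] [CompleteSpace H]

/-- The positive linear functional `f ↦ ⟨x, f(A) x⟩` on `C_c(ℝ, ℝ)`, where `f(A)` is given by the
continuous functional calculus of the self-adjoint operator `A`. -/
def spectralFunctional (A : H →L[ℂ] H) (x : H) : C_c(ℝ, ℝ) →ₚ[ℝ] ℝ :=
  PositiveLinearMap.mk₀
    { toFun := fun f => (inner ℂ x (cfc (f : ℝ → ℝ) A x)).re
      map_add' := fun f g => by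
        have h := cfc_add (a := A) (f : ℝ → ℝ) (g : ℝ → ℝ)
          f.continuous.continuousOn g.continuous.continuousOn
        have h' : cfc (⇑(f + g)) A = cfc (f : ℝ → ℝ) A + cfc (g : ℝ → ℝ) A := h
        rw [h', add_apply, inner_add_right, Complex.add_re]
      map_smul' := fun c f => by
        have h := cfc_smul c (f : ℝ → ℝ) A f.continuous.continuousOn
        have h' : cfc (⇑(c • f)) A = c • cfc (f : ℝ → ℝ) A := h
        rw [h', smul_apply, inner_smul_right_eq_smul, Complex.smul_re]
        rfl }
    (fun f hf => by
      have h : 0 ≤ cfc (f : ℝ → ℝ) A := cfc_nonneg fun t _ => hf t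
      have h2 := (ContinuousLinearMap.nonneg_iff_isPositive _).1 h
      exact h2.re_inner_nonneg_right x)

/-- The spectral measure of the self-adjoint operator `A` at the vector `x`: the regular Borel
measure `μ` on `ℝ` with `∫ f dμ = ⟨x, f(A) x⟩` for all `f ∈ C_c(ℝ, ℝ)`; equivalently
`μ(B) = ⟨x, E(B) x⟩`, where `E` is the resolution of the identity of `A`. -/
def spectralMeasure (A : H →L[ℂ] H) (x : H) : MeasureTheory.Measure ℝ :=
  RealRMK.rieszMeasure (spectralFunctional A x)

end SpectralMeasure

/-! ### The graphs `W_{n,k}` and `Z_k` -/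

/-- Vertices: `Sum.inl (i, j)` is `v_{i,j}` and `Sum.inr (i, j)` is `w_{i,j}`. -/
abbrev LayerVertex (I : Type) (k : ℕ) : Type := (I × Fin k) ⊕ (I × Fin k)

/-- Layers indexed by `I`: each `v_{i,j}` is joined to each `w_{i,l}`, and each `w_{i,j}` is joined
to `v_{i+1,j}`. -/
def layerGraph (I : Type) [Add I] [One I] (k : ℕ) : SimpleGraph (LayerVertex I k) where
  Adj
    | .inl (i, j), .inr (i', l) => i = i' ∨ (i = i' + 1 ∧ j = l)
    | .inr (i', l), .inl (i, j) => i = i' ∨ (i = i' + 1 ∧ j = l)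
    | _, _ => False
  symm := ⟨by rintro (⟨i, j⟩ | ⟨i, j⟩) (⟨i', l⟩ | ⟨i', l⟩) h <;> exact h⟩
  loopless := ⟨by rintro (⟨i, j⟩ | ⟨i, j⟩) h <;> exact h⟩

/-- The finite graph `W_{n,k}`, with first index modulo `n`. -/
abbrev graphW (n k : ℕ) : SimpleGraph (LayerVertex (ZMod n) k) := layerGraph (ZMod n) k

/-- The infinite graph `Z_k`. -/
abbrev graphZ (k : ℕ) : SimpleGraph (LayerVertex ℤ k) := layerGraph ℤ k

/-- The list of neighbours of a vertex of `Z_k`. -/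
def graphZNeighbors (k : ℕ) : LayerVertex ℤ k → Finset (LayerVertex ℤ k)
  | .inl (i, j) => insert (.inr (i - 1, j)) (Finset.univ.image fun l : Fin k => .inr (i, l))
  | .inr (i, j) => insert (.inl (i + 1, j)) (Finset.univ.image fun l : Fin k => .inl (i, l))

theorem mem_graphZNeighbors (k : ℕ) (x y : LayerVertex ℤ k) :
    y ∈ graphZNeighbors k x ↔ y ∈ (graphZ k).neighborSet x := by
  rcases x with ⟨i, j⟩ | ⟨i, j⟩ <;> rcases y with ⟨i', l⟩ | ⟨i', l⟩ <;>
    simp [graphZNeighbors, layerGraph, SimpleGraph.neighborSet] <;> grind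

instance graphZLocallyFinite (k : ℕ) : (graphZ k).LocallyFinite := fun x =>
  Fintype.ofFinset (graphZNeighbors k x) (mem_graphZNeighbors k x)

theorem graphZ_degree (k : ℕ) (x : LayerVertex ℤ k) : (graphZ k).degree x = k + 1 := by
  have h : (graphZ k).neighborFinset x = graphZNeighbors k x := by
    ext y
    rw [mem_graphZNeighbors, SimpleGraph.mem_neighborFinset, SimpleGraph.mem_neighborSet]
  rw [← SimpleGraph.card_neighborFinset_eq_degree, h]
  rcases x with ⟨i, j⟩ | ⟨i, j⟩ <;> simp only [graphZNeighbors]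
  · rw [Finset.card_insert_of_notMem (by simp; omega),
      Finset.card_image_of_injective _ (fun a b hab => by simpa using hab)]
    simp
  · rw [Finset.card_insert_of_notMem (by simp),
      Finset.card_image_of_injective _ (fun a b hab => by simpa using hab)]
    simp

/-- The adjacency operator of `Z_k` on `ℓ²`. -/
def adjZ (k : ℕ) :
    lp (fun _ : LayerVertex ℤ k => ℂ) 2 →L[ℂ] lp (fun _ : LayerVertex ℤ k => ℂ) 2 :=
  (graphZ k).adjacencyOperator (k + 1) fun v => (graphZ_degree k v).le

/-- The spectral measure of `Z_k` at the vertex `v`: that of the adjacency operator at `δ_v`. -/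
def spectralMeasureZ (k : ℕ) (v : LayerVertex ℤ k) : MeasureTheory.Measure ℝ :=
  spectralMeasure (adjZ k) (lp.single 2 v (1 : ℂ))

end

noncomputable section

/-! ### Rooted balls and coverings -/

namespace SimpleGraph

/-! Reducing the first index modulo `n` is a covering of `W_{n,k}` by `Z_k`. Layers inside a ball of
radius `r` differ by at most `2r`, so for large `n` the covering is an isomorphism on such balls;
vertex-transitivity of `W_{n,k}` brings every centre into reach.

For the spectrum, write `A = k F Q + G`: `F` swaps `v_{i,j}` with `w_{i,j}`, `G` swaps `w_{i,j}`
with `v_{i+1,j}`, and `Q` averages over the second index. As `Q` commutes with `F` and `G`, `A² = 1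
+ k Q (k + FG + GF)` (`LayerOperators.sq_eq`). Thus `A² = 1` on `ker Q`, while on the range of `Q`
it is `k² + 1 + k (D + D⁻¹)` with `D = FG` unitary. There `D` shifts the layers, so `D + D⁻¹` has
spectrum `[-2, 2]` and `A²` fills `[(k-1)², (k+1)²]`. Since `Z_k` is bipartite, `A` is conjugate to
`-A`, so the spectrum of `A` is determined by that of `A²`.

Eigenvectors for `±1` lie in `ker Q`, also when `k = 2` and `±1` are band edges, because `D` has no
eigenvalue `-1`. The atoms are therefore squared lengths of explicit projections of `δ_x`
(`spectralMeasure_singleton`). The remaining mass `1/k` lies on the two bands, and the symmetry `t ↦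
-t` splits it equally. -/

theorem mem_closedBall_iff {V : Type*} (G : SimpleGraph V) (x y : V) (r : ℕ) :
    y ∈ G.closedBall x r ↔ ∃ p : G.Walk x y, p.length ≤ r := by
  constructor
  · intro h
    have h' : G.edist x y ≤ r := h
    obtain ⟨p, hp⟩ := exists_walk_of_edist_ne_top
      (ne_top_of_le_ne_top (ENat.natCast_ne_top r) h')
    exact ⟨p, by rw [← hp] at h'; exact_mod_cast h'⟩
  · rintro ⟨p, hp⟩
    exact (edist_le p).trans (by exact_mod_cast hp)

/-- A graph homomorphism with the path lifting property that is injective and reflects adjacency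
on a ball restricts to an isomorphism of rooted balls. -/
theorem exists_closedBall_iso {V U : Type*} {G : SimpleGraph V} {H : SimpleGraph U}
    (p : G →g H) (hlift : ∀ x y, H.Adj (p x) y → ∃ z, G.Adj x z ∧ p z = y) (z : V) (r : ℕ)
    (hinj : Set.InjOn p (G.closedBall z r))
    (hadj : ∀ x ∈ G.closedBall z r, ∀ y ∈ G.closedBall z r, H.Adj (p x) (p y) → G.Adj x y) :
    ∃ φ : H.induce (H.closedBall (p z) r) ≃g G.induce (G.closedBall z r),
      φ ⟨p z, self_mem_closedBall _ _ r⟩ = ⟨z, self_mem_closedBall _ z r⟩ := by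
  have hmaps : ∀ x ∈ G.closedBall z r, p x ∈ H.closedBall (p z) r := by
    intro x hx
    obtain ⟨q, hq⟩ := (mem_closedBall_iff _ _ _ _).1 hx
    exact (mem_closedBall_iff _ _ _ _).2 ⟨q.map p, by simpa using hq⟩
  -- Lifting walks without changing their length makes the map onto the ball surjective.
  have hwalk : ∀ {a b : U} (q : H.Walk a b) (x : V), p x = a →
      ∃ (y : V) (q' : G.Walk x y), p y = b ∧ q'.length = q.length := by
    intro a b q
    induction q with
    | nil => exact fun x hx => ⟨x, .nil, hx, rfl⟩
    | cons h q ih =>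
      intro x hx
      subst hx
      obtain ⟨z, hz, hpz⟩ := hlift _ _ h
      obtain ⟨y, q', hy, hq'⟩ := ih z hpz
      exact ⟨y, .cons hz q', hy, by simp [hq']⟩
  let f : G.closedBall z r → H.closedBall (p z) r := fun x => ⟨p x, hmaps x x.2⟩
  have hf : Function.Bijective f := by
    constructor
    · intro x y hxy
      exact Subtype.ext (hinj x.2 y.2 (congrArg Subtype.val hxy))
    · rintro ⟨b, hb⟩
      obtain ⟨q, hq⟩ := (mem_closedBall_iff _ _ _ _).1 hb
      obtain ⟨y, q', hy, hq'⟩ := hwalk q z rfl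
      exact ⟨⟨y, (mem_closedBall_iff _ _ _ _).2 ⟨q', by omega⟩⟩, Subtype.ext hy⟩
  let ψ : G.induce (G.closedBall z r) ≃g H.induce (H.closedBall (p z) r) :=
    { toEquiv := Equiv.ofBijective f hf
      map_rel_iff' := by
        intro x y
        exact ⟨fun h => hadj x x.2 y y.2 h, fun h => p.map_adj h⟩ }
  refine ⟨ψ.symm, ?_⟩
  rw [RelIso.symm_apply_eq]
  rfl

end SimpleGraph

/-! ### Automorphisms, the covering, and the local limit -/

/-- Translating the layers and permuting the second index. -/
def layerShiftIso {I : Type} [CommRing I] {k : ℕ} (a : I) (σ : Equiv.Perm (Fin k)) :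
    layerGraph I k ≃g layerGraph I k where
  toEquiv := Equiv.sumCongr ((Equiv.addRight a).prodCongr σ) ((Equiv.addRight a).prodCongr σ)
  map_rel_iff' := by
    rintro (⟨i, j⟩ | ⟨i, j⟩) (⟨i', l⟩ | ⟨i', l⟩) <;>
      simp [layerGraph, add_right_comm _ a 1, add_left_inj]

/-- The reflection that exchanges `v_{i,j}` and `w_{-i,j}`. -/
def layerFlipIso {I : Type} [CommRing I] {k : ℕ} : layerGraph I k ≃g layerGraph I k where
  toEquiv := (Equiv.sumComm _ _).trans (Equiv.sumCongr
    ((Equiv.neg I).prodCongr (Equiv.refl _)) ((Equiv.neg I).prodCongr (Equiv.refl _)))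
  map_rel_iff' := by
    rintro (⟨i, j⟩ | ⟨i, j⟩) (⟨i', l⟩ | ⟨i', l⟩) <;>
      simp [layerGraph] <;> grind

theorem layerGraph_isVertexTransitive (I : Type) [CommRing I] (k : ℕ) :
    (layerGraph I k).IsVertexTransitive := by
  have hshift : ∀ (i i' : I) (j j' : Fin k), ∃ φ : layerGraph I k ≃g layerGraph I k,
      φ (.inl (i, j)) = .inl (i', j') ∧ φ (.inr (i, j)) = .inr (i', j') := fun i i' j j' =>
    ⟨layerShiftIso (i' - i) (Equiv.swap j j'), by simp [layerShiftIso], by simp [layerShiftIso]⟩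
  have hflip : ∀ (i : I) (j : Fin k), (layerFlipIso : layerGraph I k ≃g layerGraph I k)
      (.inl (i, j)) = .inr (-i, j) ∧ (layerFlipIso : layerGraph I k ≃g layerGraph I k)
      (.inr (i, j)) = .inl (-i, j) := fun i j => ⟨rfl, rfl⟩
  rintro (⟨i, j⟩ | ⟨i, j⟩) (⟨i', j'⟩ | ⟨i', j'⟩)
  · obtain ⟨φ, h, -⟩ := hshift i i' j j'
    exact ⟨φ, h⟩
  · obtain ⟨φ, -, h⟩ := hshift (-i) i' j j'
    exact ⟨layerFlipIso.trans φ, by rw [RelIso.trans_apply, (hflip i j).1, h]⟩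
  · obtain ⟨φ, h, -⟩ := hshift (-i) i' j j'
    exact ⟨layerFlipIso.trans φ, by rw [RelIso.trans_apply, (hflip i j).2, h]⟩
  · obtain ⟨φ, -, h⟩ := hshift i i' j j'
    exact ⟨φ, h⟩

/-- The covering `Z_k → W_{n,k}` reducing the first index modulo `n`. -/
def layerCover (n k : ℕ) : graphZ k →g graphW n k where
  toFun := Sum.map (Prod.map Int.cast id) (Prod.map Int.cast id)
  map_rel' := by
    rintro (⟨i, j⟩ | ⟨i, j⟩) (⟨i', l⟩ | ⟨i', l⟩) <;> simp [layerGraph]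
    · rintro (rfl | ⟨rfl, rfl⟩) <;> simp
    · rintro (rfl | ⟨rfl, rfl⟩) <;> simp

theorem layerCover_lift (n k : ℕ) (x : LayerVertex ℤ k) (y : LayerVertex (ZMod n) k)
    (h : (graphW n k).Adj (layerCover n k x) y) :
    ∃ z, (graphZ k).Adj x z ∧ layerCover n k z = y := by
  rcases x with ⟨i, j⟩ | ⟨i, j⟩ <;> rcases y with ⟨i', l⟩ | ⟨i', l⟩
  · exact h.elim
  · rcases h with h | ⟨h, rfl⟩
    · exact ⟨.inr (i, l), Or.inl rfl, by simp only [← h]; rfl⟩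
    · refine ⟨.inr (i - 1, j), Or.inr ⟨by ring, rfl⟩, ?_⟩
      have h' : ((i - 1 : ℤ) : ZMod n) = i' := by
        push_cast
        exact sub_eq_of_eq_add h
      simp only [← h']
      rfl
  · rcases h with h | ⟨h, rfl⟩
    · exact ⟨.inl (i, l), Or.inl rfl, by simp only [h]; rfl⟩
    · refine ⟨.inl (i + 1, l), Or.inr ⟨rfl, rfl⟩, ?_⟩
      have h' : ((i + 1 : ℤ) : ZMod n) = i' := by
        push_cast
        exact h.symm
      simp only [← h']
      rfl
  · exact h.elim

/-- The first index of a vertex. -/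
def LayerVertex.layer {I : Type} {k : ℕ} : LayerVertex I k → I :=
  Sum.elim Prod.fst Prod.fst

/-- Every edge changes the layer by at most one. -/
theorem abs_layer_sub_le_of_walk {k : ℕ} {x y : LayerVertex ℤ k} (p : (graphZ k).Walk x y) :
    |LayerVertex.layer y - LayerVertex.layer x| ≤ p.length := by
  induction p with
  | nil => simp
  | @cons u v w h p ih =>
    have hstep : |LayerVertex.layer v - LayerVertex.layer u| ≤ 1 := by
      rcases u with ⟨i, j⟩ | ⟨i, j⟩ <;> rcases v with ⟨i', l⟩ | ⟨i', l⟩ <;>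
        simp only [layerGraph, LayerVertex.layer, Sum.elim_inl, Sum.elim_inr] at h ⊢ <;>
        first | exact h.elim | (rcases h with h | ⟨h, -⟩ <;> subst h <;> simp)
    rw [SimpleGraph.Walk.length_cons]
    push_cast
    rw [abs_le] at *
    omega

theorem abs_layer_sub_le {k : ℕ} {z x y : LayerVertex ℤ k} {r : ℕ}
    (hx : x ∈ (graphZ k).closedBall z r) (hy : y ∈ (graphZ k).closedBall z r) :
    |LayerVertex.layer x - LayerVertex.layer y| ≤ 2 * r := by
  obtain ⟨p, hp⟩ := (SimpleGraph.mem_closedBall_iff _ _ _ _).1 hx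
  obtain ⟨q, hq⟩ := (SimpleGraph.mem_closedBall_iff _ _ _ _).1 hy
  have h1 := abs_layer_sub_le_of_walk p
  have h2 := abs_layer_sub_le_of_walk q
  rw [abs_le] at *
  omega

theorem ZMod.intCast_inj_of_abs_sub_lt {n : ℕ} {a b : ℤ} (h : |a - b| < n)
    (hab : (a : ZMod n) = b) : a = b := by
  have h1 : ((a - b : ℤ) : ZMod n) = 0 := by simp [hab]
  rw [ZMod.intCast_zmod_eq_zero_iff_dvd] at h1
  exact sub_eq_zero.1 (Int.eq_zero_of_abs_lt_dvd h1 h)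

theorem isLocalLimit_graphW (k : ℕ) :
    SimpleGraph.IsLocalLimit (fun n => graphW n k) (graphZ k) := by
  intro r
  -- Injectivity needs only `2r < n`; reflecting adjacency compares `a` with `b + 1`, whose distance
  -- can reach `2r + 1`.
  filter_upwards [Filter.eventually_gt_atTop (2 * r + 1)] with n hn x z
  -- The covering followed by an automorphism of `W_{n,k}` sends `z` to the prescribed centre.
  obtain ⟨α, rfl⟩ := layerGraph_isVertexTransitive (ZMod n) k (layerCover n k z) x
  refine SimpleGraph.exists_closedBall_iso (α.toHom.comp (layerCover n k)) ?_ z r ?_ ?_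
  · intro x y h
    have h' : (graphW n k).Adj (layerCover n k x) (α.symm y) := by
      rw [← α.map_adj_iff]
      simpa using h
    obtain ⟨z, hz, hy⟩ := layerCover_lift n k x _ h'
    exact ⟨z, hz, by simp [hy]⟩
  · intro x hx y hy hxy
    have h1 := abs_layer_sub_le hx hy
    have h2 : layerCover n k x = layerCover n k y := α.injective hxy
    have key : LayerVertex.layer x = LayerVertex.layer y := by
      refine ZMod.intCast_inj_of_abs_sub_lt (n := n) (by omega) ?_
      rcases x with ⟨i, j⟩ | ⟨i, j⟩ <;> rcases y with ⟨i', l⟩ | ⟨i', l⟩ <;>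
        simp_all [layerCover, LayerVertex.layer]
    rcases x with ⟨i, j⟩ | ⟨i, j⟩ <;> rcases y with ⟨i', l⟩ | ⟨i', l⟩ <;>
      simp_all [layerCover, LayerVertex.layer]
  · intro x hx y hy hxy
    have h1 := abs_layer_sub_le hx hy
    have h2 : (graphW n k).Adj (layerCover n k x) (layerCover n k y) := α.map_adj_iff.1 hxy
    have hcast : ∀ a b : ℤ, |a - b| ≤ 2 * r →
        ((a : ZMod n) = b → a = b) ∧ ((a : ZMod n) = b + 1 → a = b + 1) := fun a b hab =>
      ⟨fun h => ZMod.intCast_inj_of_abs_sub_lt (n := n) (by omega) h,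
        fun h => ZMod.intCast_inj_of_abs_sub_lt (n := n)
          (by rw [abs_le] at hab; rw [abs_lt]; omega) (by push_cast; exact h)⟩
    rcases x with ⟨i, j⟩ | ⟨i, j⟩ <;> rcases y with ⟨i', l⟩ | ⟨i', l⟩
    · exact h2.elim
    · exact h2.imp (hcast _ _ h1).1 (And.imp_left (hcast _ _ h1).2)
    · rw [abs_sub_comm] at h1
      exact h2.imp (hcast _ _ h1).1 (And.imp_left (hcast _ _ h1).2)
    · exact h2.elim

/-! ### Spectral measures: support, symmetry, atoms -/

section SpectralMeasure

open MeasureTheory Filter Topology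

variable {H : Type*} [NormedAddCommGroup H] [InnerProductSpace ℂ H] [CompleteSpace H]

theorem integral_spectralMeasure (A : H →L[ℂ] H) (x : H) (f : C_c(ℝ, ℝ)) :
    ∫ t, f t ∂(spectralMeasure A x) = (inner ℂ x (cfc (f : ℝ → ℝ) A x)).re :=
  RealRMK.integral_rieszMeasure (spectralFunctional A x) f

instance spectralMeasure_regular (A : H →L[ℂ] H) (x : H) : (spectralMeasure A x).Regular :=
  RealRMK.regular_rieszMeasure (spectralFunctional A x)

/-- By inner regularity it suffices to treat a compact set off the spectrum. A Urysohn function for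
it supported off the spectrum has zero functional calculus and dominates the measure of the set. -/
theorem spectralMeasure_compl_spectrum (A : H →L[ℂ] H) (x : H) :
    spectralMeasure A x (spectrum ℝ A)ᶜ = 0 := by
  have hopen : IsOpen (spectrum ℝ A)ᶜ := (spectrum.isClosed A).isOpen_compl
  rw [hopen.measure_eq_iSup_isCompact]
  simp only [ENNReal.iSup_eq_zero]
  intro K hK hKc
  obtain ⟨f, hf1, hfc, hfs, hf01⟩ :=
    exists_continuousMap_one_of_isCompact_subset_isOpen hKc hopen hK
  have hle := RealRMK.rieszMeasure_le_of_eq_one (spectralFunctional A x)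
    (f := ⟨f, hfc⟩) (fun t => (hf01 t).1) hKc (fun t ht => hf1 ht)
  have hzero : cfc (f : ℝ → ℝ) A = 0 := by
    rw [cfc_congr (g := fun _ => (0 : ℝ)), cfc_const_zero]
    intro t ht
    by_contra hne
    exact hfs (subset_tsupport _ hne) ht
  have hval : spectralFunctional A x ⟨f, hfc⟩ = 0 := by
    have h : spectralFunctional A x ⟨f, hfc⟩ = (inner ℂ x (cfc (f : ℝ → ℝ) A x)).re := rfl
    rw [h, hzero]
    simp
  rw [hval, ENNReal.ofReal_zero] at hle
  exact le_antisymm hle zero_le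

theorem ae_mem_spectrum (A : H →L[ℂ] H) (x : H) :
    ∀ᵐ t ∂(spectralMeasure A x), t ∈ spectrum ℝ A :=
  spectralMeasure_compl_spectrum A x

instance spectralMeasure_isFiniteMeasure (A : H →L[ℂ] H) (x : H) :
    IsFiniteMeasure (spectralMeasure A x) := by
  constructor
  rw [← Set.union_compl_self (spectrum ℝ A)]
  refine (measure_union_le _ _).trans_lt ?_
  rw [spectralMeasure_compl_spectrum, add_zero]
  exact (spectrum.isCompact A).measure_lt_top

/-- The defining identity of the spectral measure holds for every continuous function. -/
theorem integral_spectralMeasure_of_continuous (A : H →L[ℂ] H) (x : H) {f : ℝ → ℝ}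
    (hf : Continuous f) :
    ∫ t, f t ∂(spectralMeasure A x) = (inner ℂ x (cfc f A x)).re := by
  -- A cutoff equal to `1` on the spectrum changes neither side and makes the integrand compactly
  -- supported.
  obtain ⟨χ, hχ1, hχc, -, -⟩ := exists_continuousMap_one_of_isCompact_subset_isOpen
    (spectrum.isCompact (𝕜 := ℝ) A) isOpen_univ (Set.subset_univ _)
  let g : C_c(ℝ, ℝ) := ⟨⟨fun t => χ t * f t, by fun_prop⟩,
    HasCompactSupport.mul_right (f := χ) (f' := f) hχc⟩
  have hg : Set.EqOn g f (spectrum ℝ A) := fun t ht => by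
    change χ t * f t = f t
    rw [hχ1 ht, Pi.one_apply, one_mul]
  rw [← cfc_congr hg, ← integral_spectralMeasure]
  refine integral_congr_ae ?_
  filter_upwards [ae_mem_spectrum A x] with t ht
  exact (hg ht).symm

theorem spectralMeasure_univ {A : H →L[ℂ] H} (hA : IsSelfAdjoint A) (x : H) :
    spectralMeasure A x Set.univ = ENNReal.ofReal (‖x‖ ^ 2) := by
  have h := integral_spectralMeasure_of_continuous A x (f := fun _ => 1) continuous_const
  rw [cfc_const_one ℝ A] at h
  simp only [integral_const, smul_eq_mul, mul_one, one_apply_eq_self] at h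
  rw [inner_self_eq_norm_sq_to_K] at h
  rw [← ofReal_measureReal, h]
  congr 1
  exact_mod_cast rfl

/-- An operator that anticommutes with a self-adjoint unitary `U` has symmetric spectral measure
at every eigenvector of `U`. -/
theorem spectralMeasure_map_neg {A U : H →L[ℂ] H} (hA : IsSelfAdjoint A) (hU : IsSelfAdjoint U)
    (hUU : U * U = 1) (hUA : U * A * U = -A) {x : H} {ε : ℂ} (hx : U x = ε • x)
    (hε : star ε * ε = 1) :
    (spectralMeasure A x).map (fun t => -t) = spectralMeasure A x := by
  have hmem : U ∈ unitary (H →L[ℂ] H) := by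
    rw [Unitary.mem_iff, hU.star_eq]
    exact ⟨hUU, hUU⟩
  have hcfc : ∀ f : ℝ → ℝ, Continuous f → cfc (fun t => f (-t)) A = U * cfc f A * U := by
    intro f hf
    rw [cfc_comp_neg f A hf.continuousOn, ← hUA]
    -- Conjugation by the unitary `U` is a star automorphism, so it commutes with the functional
    -- calculus.
    have h := StarAlgHomClass.map_cfc (S := ℂ) (Unitary.conjStarAlgAut ℂ (H →L[ℂ] H) ⟨U, hmem⟩) f A
      hf.continuousOn (by
        change Continuous fun a : H →L[ℂ] H => U * a * star U
        fun_prop) hA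
      (by
        change IsSelfAdjoint (U * A * star U)
        rw [hU.star_eq, hUA]
        exact hA.neg)
    rw [Unitary.conjStarAlgAut_apply, Unitary.conjStarAlgAut_apply] at h
    simp only [hU.star_eq] at h
    exact h.symm
  have hreg : ((spectralMeasure A x).map (fun t => -t)).Regular :=
    Measure.Regular.map (μ := spectralMeasure A x) (Homeomorph.neg ℝ)
  refine Measure.ext_of_integral_eq_on_compactlySupported fun f => ?_
  rw [integral_map (by fun_prop) (by fun_prop), integral_spectralMeasure,
    integral_spectralMeasure_of_continuous A x (f := fun t => f (-t)) (by fun_prop),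
    hcfc f f.continuous]
  congr 1
  rw [mul_apply_eq_comp, mul_apply_eq_comp,
    ← ContinuousLinearMap.adjoint_inner_left, ← ContinuousLinearMap.star_eq_adjoint, hU.star_eq, hx,
    map_smul, inner_smul_left, inner_smul_right, ← mul_assoc]
  simp only [starRingEnd_apply, hε, one_mul]

/-- The mass of an atom of the spectral measure is the squared length of the projection to the
eigenspace. -/
theorem spectralMeasure_singleton {A : H →L[ℂ] H} (hA : IsSelfAdjoint A) {x p : H} {c : ℝ}
    (hp : A p = c • p) (hperp : ∀ y, A y = c • y → inner ℂ (x - p) y = 0) :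
    spectralMeasure A x {c} = ENNReal.ofReal (‖p‖ ^ 2) := by
  obtain ⟨R, hR⟩ : ∃ R : ℝ, ∀ t ∈ spectrum ℝ A, |t - c| ≤ R := by
    obtain ⟨R, hR⟩ := (spectrum.isBounded (𝕜 := ℝ) A).subset_closedBall c
    exact ⟨R, fun t ht => by simpa [Real.dist_eq] using hR ht⟩
  -- With this `M` the parabola `h` takes values in `[0, 1]` on the spectrum and equals `1` only at
  -- `c`; the summand `1` keeps `M` positive. The powers of `h` then converge to the indicator of
  -- `{c}`.
  set M : ℝ := R ^ 2 + 1 with hM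
  have hMpos : 0 < M := by positivity
  let h : ℝ → ℝ := fun t => 1 - (t - c) * (t - c) / M
  have hcont : Continuous h := by fun_prop
  have hbound : ∀ t ∈ spectrum ℝ A, 0 ≤ h t ∧ h t ≤ 1 := by
    intro t ht
    have h1 : (t - c) * (t - c) ≤ M := by
      rw [← abs_mul_abs_self]
      have := hR t ht
      have := abs_nonneg (t - c)
      nlinarith
    exact ⟨sub_nonneg.2 (by rwa [div_le_one hMpos]),
      sub_le_self _ (div_nonneg (mul_self_nonneg _) hMpos.le)⟩
  let C : H →L[ℂ] H := A - algebraMap ℝ _ c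
  have hCsa : IsSelfAdjoint C := hA.sub (IsSelfAdjoint.algebraMap _ (IsSelfAdjoint.all c))
  have hCapply : ∀ y, C y = A y - c • y := fun y => by
    simp [C, Algebra.algebraMap_eq_smul_one]
  let B : H →L[ℂ] H := cfc h A
  have hB : B = 1 - M⁻¹ • (C * C) := by
    have h1 : cfc (fun t : ℝ => t - c) A = C := by
      rw [cfc_sub (a := A) (fun t : ℝ => t) (fun _ => c), cfc_id' ℝ A, cfc_const c A]
    have h2 : cfc (fun t : ℝ => M⁻¹ • ((t - c) * (t - c))) A = M⁻¹ • (C * C) := by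
      rw [cfc_smul M⁻¹ (fun t : ℝ => (t - c) * (t - c)) A,
        cfc_mul (fun t : ℝ => t - c) (fun t : ℝ => t - c) A, h1]
    change cfc h A = _
    rw [← h2, ← cfc_const_one ℝ A, ← cfc_sub (a := A) (fun _ : ℝ => (1 : ℝ))
      (fun t : ℝ => M⁻¹ • ((t - c) * (t - c)))]
    refine cfc_congr fun t _ => ?_
    simp only [h, smul_eq_mul]
    ring
  have hBnorm : ‖B‖ ≤ 1 := norm_cfc_le zero_le_one fun t ht => by
    rw [Real.norm_eq_abs, abs_of_nonneg (hbound t ht).1]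
    exact (hbound t ht).2
  have hfix : ∀ y, B y = y ↔ A y = c • y := by
    intro y
    rw [hB, sub_apply, one_apply_eq_self, smul_apply, sub_eq_self,
      smul_eq_zero_iff_right (inv_ne_zero hMpos.ne'), ← sub_eq_zero (a := A y), ← hCapply,
      mul_apply_eq_comp]
    refine ⟨fun hy => ?_, fun hy => by rw [hy, map_zero]⟩
    -- `‖C y‖² = ⟨y, C² y⟩ = 0` since `C` is self-adjoint.
    rw [← inner_self_eq_zero (𝕜 := ℂ)]
    nth_rewrite 1 [← hCsa.star_eq]
    rw [ContinuousLinearMap.star_eq_adjoint, ContinuousLinearMap.adjoint_inner_left, hy,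
      inner_zero_right]
  have hproj : ((B.eqLocus (1 : H →L[ℂ] H)).orthogonalProjectionOnto x : H) = p := by
    refine Submodule.eq_starProjection_of_mem_of_inner_eq_zero ?_ ?_
    · exact (hfix p).2 hp
    · exact fun w hw => hperp w ((hfix w).1 hw)
  -- Von Neumann's mean ergodic theorem: the averages of `B ^ n x` converge to the projection of `x`
  -- to the fixed space of `B`, which is the eigenspace of `A` for `c`. Pairing with `x` gives
  -- Cesàro means of the moments `∫ h ^ n`, whose limit is also the mass of `{c}`.
  have hergodic := B.tendsto_birkhoffAverage_orthogonalProjection hBnorm x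
  rw [hproj] at hergodic
  have hmoment : ∀ n : ℕ, (inner ℂ x ((B ^ n) x)).re = ∫ t, h t ^ n ∂(spectralMeasure A x) := by
    intro n
    rw [integral_spectralMeasure_of_continuous A x (f := fun t => h t ^ n) (by fun_prop),
      cfc_pow h n A]
  have hlim1 : Tendsto (fun n : ℕ => ∫ t, h t ^ n ∂(spectralMeasure A x)) atTop
      (𝓝 (∫ t, Set.indicator {c} 1 t ∂(spectralMeasure A x))) := by
    refine tendsto_integral_of_dominated_convergence (fun _ => 1)
      (fun n => (hcont.pow n).aestronglyMeasurable) (integrable_const _) ?_ ?_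
    · intro n
      filter_upwards [ae_mem_spectrum A x] with t ht
      rw [Real.norm_eq_abs, abs_of_nonneg (pow_nonneg (hbound t ht).1 n)]
      exact pow_le_one₀ (hbound t ht).1 (hbound t ht).2
    · filter_upwards [ae_mem_spectrum A x] with t ht
      by_cases htc : t = c
      · subst htc
        simp [h]
      · rw [Set.indicator_of_notMem (by simpa using htc)]
        refine tendsto_pow_atTop_nhds_zero_of_lt_one (hbound t ht).1 (sub_lt_self _ ?_)
        exact div_pos (mul_self_pos.2 (sub_ne_zero.2 htc)) hMpos
  rw [integral_indicator_one (measurableSet_singleton c)] at hlim1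
  have hlim2 : Tendsto (fun n : ℕ => (n⁻¹ : ℝ) * ∑ i ∈ Finset.range n,
      ∫ t, h t ^ i ∂(spectralMeasure A x)) atTop (𝓝 (inner ℂ x p).re) := by
    have h3 := (Complex.continuous_re.tendsto _).comp
      ((tendsto_const_nhds (x := x)).inner (𝕜 := ℂ) hergodic)
    refine h3.congr fun n => ?_
    simp only [← hmoment, Function.comp_apply, birkhoffAverage, birkhoffSum, inner_smul_right,
      inner_sum, id_eq]
    have hcast : ((n : ℂ)⁻¹) = (((n : ℝ)⁻¹ : ℝ) : ℂ) := by push_cast; rfl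
    rw [hcast, Complex.re_ofReal_mul, Complex.re_sum]
    simp
  have hxp : (inner ℂ x p).re = ‖p‖ ^ 2 := by
    have h4 := hperp p hp
    rw [inner_sub_left, sub_eq_zero] at h4
    rw [h4, inner_self_eq_norm_sq_to_K]
    exact_mod_cast rfl
  rw [← ofReal_measureReal, tendsto_nhds_unique hlim1.cesaro hlim2, hxp]

end SpectralMeasure

/-! ### The operator identity `A = k F Q + G` and its consequences -/

section LayerOperators

variable {H : Type*} [NormedAddCommGroup H] [InnerProductSpace ℂ H] [CompleteSpace H]

/-- The relations satisfied by the adjacency operator of `Z_k`: it is `k F Q + G` for two symmetries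
`F`, `G` and a projection `Q` that commutes with both, and the symmetry `U` changes its sign. -/
structure LayerOperators (k : ℕ) (A F G Q U : H →L[ℂ] H) : Prop where
  eq_add : A = (k : ℂ) • (F * Q) + G
  F_mul_F : F * F = 1
  G_mul_G : G * G = 1
  Q_mul_Q : Q * Q = Q
  U_mul_U : U * U = 1
  F_mul_Q : F * Q = Q * F
  G_mul_Q : G * Q = Q * G
  U_mul_A_mul_U : U * A * U = -A
  star_F : IsSelfAdjoint F
  star_G : IsSelfAdjoint G
  star_Q : IsSelfAdjoint Q
  /-- The unitary `F G` does not have the eigenvalue `-1`. -/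
  eq_zero_of_FG : ∀ y, F (G y) = -y → y = 0

namespace LayerOperators

variable {k : ℕ} {A F G Q U : H →L[ℂ] H} (h : LayerOperators k A F G Q U)
include h

theorem isSelfAdjoint : IsSelfAdjoint A := by
  rw [h.eq_add]
  refine IsSelfAdjoint.add (IsSelfAdjoint.smul ?_ ?_) h.star_G
  · simp [IsSelfAdjoint]
  · exact (h.star_F.commute_iff h.star_Q).1 h.F_mul_Q

theorem commute_A_Q : A * Q = Q * A := by
  rw [h.eq_add, add_mul, mul_add, smul_mul_assoc, mul_smul_comm, h.G_mul_Q, ← mul_assoc Q F,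
    ← h.F_mul_Q]

/-- `(FQ)² = Q` and `G² = 1`, and the cross terms combine to `Q (FG + GF)`. This reduces the study
of `A` to the cases `Q y = 0` and `Q y = y`. -/
theorem sq_eq : A * A = 1 + (k : ℂ) • (Q * ((k : ℂ) • 1 + (F * G + G * F))) := by
  have h1 : F * Q * (F * Q) = Q := by
    rw [mul_assoc, ← mul_assoc Q F, ← h.F_mul_Q, mul_assoc F Q, h.Q_mul_Q, ← mul_assoc, h.F_mul_F,
      one_mul]
  have h2 : F * Q * G = Q * (F * G) := by rw [h.F_mul_Q, mul_assoc]
  have h3 : G * (F * Q) = Q * (G * F) := by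
    rw [h.F_mul_Q, ← mul_assoc, h.G_mul_Q, mul_assoc]
  rw [h.eq_add, add_mul, mul_add, mul_add, smul_mul_smul_comm, smul_mul_assoc, mul_smul_comm, h1,
    h2, h3, h.G_mul_G, mul_add, mul_add, smul_add, smul_add, mul_smul_comm, mul_one, smul_smul]
  abel

theorem sq_apply (y : H) :
    A (A y) = y + (k : ℂ) • Q ((k : ℂ) • y + (F (G y) + G (F y))) :=
  congrArg (fun T : H →L[ℂ] H => T y) h.sq_eq

theorem commute_Q_FG : Commute Q (F * G + G * F) := by
  have hF : Commute Q F := h.F_mul_Q.symm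
  have hG : Commute Q G := h.G_mul_Q.symm
  exact (hF.mul_right hG).add_right (hG.mul_right hF)

theorem commute_Q_FG_apply (y : H) :
    Q (F (G y) + G (F y)) = F (G (Q y)) + G (F (Q y)) :=
  congrArg (fun T : H →L[ℂ] H => T y) h.commute_Q_FG.eq

theorem sq_apply_of_Q_eq_zero {y : H} (hy : Q y = 0) : A (A y) = y := by
  rw [h.sq_apply, map_add, h.commute_Q_FG_apply]
  simp [hy]

theorem sq_apply_of_Q_eq_self {y : H} (hy : Q y = y) :
    A (A y) = y + (k : ℂ) • ((k : ℂ) • y + (F (G y) + G (F y))) := by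
  rw [h.sq_apply, map_add, h.commute_Q_FG_apply, map_smul, hy]

theorem F_apply_F (y : H) : F (F y) = y := congrArg (fun T : H →L[ℂ] H => T y) h.F_mul_F

theorem G_apply_G (y : H) : G (G y) = y := congrArg (fun T : H →L[ℂ] H => T y) h.G_mul_G

theorem F_inner (x y : H) : inner ℂ (F x) y = inner ℂ x (F y) := h.star_F.isSymmetric x y

theorem G_inner (x y : H) : inner ℂ (G x) y = inner ℂ x (G y) := h.star_G.isSymmetric x y

theorem A_inner (x y : H) : inner ℂ (A x) y = inner ℂ x (A y) := h.isSelfAdjoint.isSymmetric x y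

theorem Q_inner (x y : H) : inner ℂ (Q x) y = inner ℂ x (Q y) := h.star_Q.isSymmetric x y

theorem norm_F (x : H) : ‖F x‖ = ‖x‖ := by
  have h1 : inner ℂ (F x) (F x) = inner ℂ x x := by rw [h.F_inner, h.F_apply_F]
  rw [norm_eq_sqrt_re_inner (𝕜 := ℂ) (F x), h1, ← norm_eq_sqrt_re_inner]

theorem norm_G (x : H) : ‖G x‖ = ‖x‖ := by
  have h1 : inner ℂ (G x) (G x) = inner ℂ x x := by rw [h.G_inner, h.G_apply_G]
  rw [norm_eq_sqrt_re_inner (𝕜 := ℂ) (G x), h1, ← norm_eq_sqrt_re_inner]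

/-! ### The eigenvectors for the eigenvalues `1` and `-1` -/

/-- The component `z = Q y` satisfies `A² z = z`, hence `k z + FG z + GF z = 0`. Then `‖FG z + z‖² =
(2 - k) ‖z‖² ≤ 0`, so `FG z = -z` and `z = 0`. -/
theorem Q_eq_zero_of_eigenvector (hk : 2 ≤ k) {c : ℝ} (hc : c * c = 1) {y : H}
    (hy : A y = c • y) : Q y = 0 := by
  set z := Q y with hz
  have hQz : Q z = z := congrArg (fun T : H →L[ℂ] H => T y) h.Q_mul_Q
  have hAz : A z = c • z := by
    have h1 : A (Q y) = Q (A y) := congrArg (fun T : H →L[ℂ] H => T y) h.commute_A_Q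
    rw [hz, h1, hy, ContinuousLinearMap.map_smul_of_tower]
  have hAAz : A (A z) = z := by
    rw [hAz, ContinuousLinearMap.map_smul_of_tower, hAz, smul_smul, hc, one_smul]
  have hk0 : (k : ℂ) ≠ 0 := by exact_mod_cast (by omega : k ≠ 0)
  rw [h.sq_apply_of_Q_eq_self hQz, add_eq_left, smul_eq_zero_iff_right hk0] at hAAz
  apply h.eq_zero_of_FG
  have hinner : inner ℂ z (F (G z)) + inner ℂ z (G (F z)) = -(k : ℂ) * inner ℂ z z := by
    have h2 := congrArg (inner ℂ z) hAAz
    rw [inner_add_right, inner_add_right, inner_smul_right, inner_zero_right] at h2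
    linear_combination h2
  have hself : inner ℂ (F (G z) + z) (F (G z) + z) = ((2 - k : ℝ) : ℂ) * inner ℂ z z := by
    rw [inner_add_left, inner_add_right, inner_add_right, h.F_inner, h.F_apply_F, h.G_inner,
      h.G_apply_G, h.F_inner, h.G_inner]
    push_cast
    linear_combination hinner
  rw [inner_self_eq_norm_sq_to_K, inner_self_eq_norm_sq_to_K] at hself
  have hreal : ‖F (G z) + z‖ ^ 2 = (2 - k) * ‖z‖ ^ 2 := Complex.ofReal_injective (by
    rw [Complex.ofReal_mul, Complex.ofReal_pow, Complex.ofReal_pow]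
    exact hself)
  have hle : (2 - k : ℝ) * ‖z‖ ^ 2 ≤ 0 :=
    mul_nonpos_of_nonpos_of_nonneg (sub_nonpos.2 (by exact_mod_cast hk)) (sq_nonneg _)
  rw [← hreal] at hle
  rw [← add_eq_zero_iff_eq_neg, ← norm_eq_zero]
  exact pow_eq_zero_iff two_ne_zero |>.1 (le_antisymm hle (sq_nonneg _))

theorem spectralMeasure_singleton_eq (hk : 2 ≤ k) {c : ℝ} (hc : c * c = 1) {x : H}
    (hx : inner ℂ x x = 1) (hQx : inner ℂ x (Q x) = ((1 / k : ℝ) : ℂ))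
    (hAx : inner ℂ x (A (x - Q x)) = 0) :
    spectralMeasure A x {c} = ENNReal.ofReal (1 / 2 - 1 / (2 * k)) := by
  set u := x - Q x with hu
  have hQu : Q u = 0 := by
    have h1 : Q (Q x) = Q x := congrArg (fun T : H →L[ℂ] H => T x) h.Q_mul_Q
    rw [hu, map_sub, h1, sub_self]
  have hAAu := h.sq_apply_of_Q_eq_zero hQu
  -- As `A² u = u`, the operator `(1 + c A) / 2` projects `u` to the eigenspace for `c`; the part `Q
  -- x` is orthogonal to that eigenspace.
  have hp : A ((1 / 2 : ℝ) • (u + c • A u)) = c • (1 / 2 : ℝ) • (u + c • A u) := by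
    rw [ContinuousLinearMap.map_smul_of_tower, map_add, ContinuousLinearMap.map_smul_of_tower, hAAu,
      smul_comm c, smul_add c, smul_smul c, hc, one_smul, add_comm]
  have hperp : ∀ y, A y = c • y → inner ℂ (x - (1 / 2 : ℝ) • (u + c • A u)) y = 0 := by
    intro y hy
    have hcc : (c : ℂ) * c = 1 := by exact_mod_cast hc
    have hy0 := h.Q_eq_zero_of_eigenvector hk hc hy
    have huy : inner ℂ u y = inner ℂ x y := by
      rw [hu, inner_sub_left, h.Q_inner, hy0, inner_zero_right, sub_zero]
    rw [inner_sub_left, RCLike.real_smul_eq_coe_smul (K := ℂ), inner_smul_left, inner_add_left,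
      RCLike.real_smul_eq_coe_smul (K := ℂ) c, inner_smul_left, h.A_inner, hy,
      RCLike.real_smul_eq_coe_smul (K := ℂ) c, inner_smul_right, huy]
    simp only [RCLike.ofReal_eq_complex_ofReal, Complex.conj_ofReal]
    push_cast
    linear_combination (-1 / 2 * inner ℂ x y) * hcc
  rw [spectralMeasure_singleton h.isSelfAdjoint hp hperp]
  congr 1
  set p := (1 / 2 : ℝ) • (u + c • A u) with hpdef
  have h5 : inner ℂ p p = inner ℂ x p := by
    have h6 := hperp p hp
    rw [inner_sub_left, sub_eq_zero] at h6
    exact h6.symm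
  have h7 : inner ℂ x p = ((1 / 2 - 1 / (2 * k) : ℝ) : ℂ) := by
    rw [hpdef, RCLike.real_smul_eq_coe_smul (K := ℂ), inner_smul_right, inner_add_right,
      RCLike.real_smul_eq_coe_smul (K := ℂ) c, inner_smul_right, hAx, hu, inner_sub_right, hx, hQx]
    simp only [RCLike.ofReal_eq_complex_ofReal]
    push_cast
    ring
  rw [h7, inner_self_eq_norm_sq_to_K] at h5
  refine Complex.ofReal_injective ?_
  rw [Complex.ofReal_pow]
  exact h5

/-! ### The spectrum -/

theorem isUnit_U : IsUnit U := ⟨⟨U, U, h.U_mul_U, h.U_mul_U⟩, rfl⟩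

theorem isUnit_sub_iff (z : ℂ) :
    IsUnit (algebraMap ℂ (H →L[ℂ] H) z - A) ↔ IsUnit (algebraMap ℂ (H →L[ℂ] H) z + A) := by
  have h1 : U * (algebraMap ℂ (H →L[ℂ] H) z - A) * U = algebraMap ℂ (H →L[ℂ] H) z + A := by
    rw [mul_sub, sub_mul, h.U_mul_A_mul_U, ← Algebra.commutes, mul_assoc, h.U_mul_U, mul_one,
      sub_neg_eq_add]
  rw [← h1]
  refine ⟨fun h2 => (h.isUnit_U.mul h2).mul h.isUnit_U, fun h2 => ?_⟩
  have h3 := (h.isUnit_U.mul h2).mul h.isUnit_U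
  rwa [← mul_assoc, ← mul_assoc, h.U_mul_U, one_mul, mul_assoc, h.U_mul_U, mul_one] at h3

/-- `z² - A²` is the product of the commuting factors `z - A` and `z + A`, which are conjugate under
`U` and so invertible together. -/
theorem mem_spectrum_iff (z : ℂ) :
    z ∈ spectrum ℂ A ↔ ¬ IsUnit (algebraMap ℂ (H →L[ℂ] H) (z * z) - A * A) := by
  rw [spectrum.mem_iff, not_iff_not]
  have hcomm : Commute (algebraMap ℂ (H →L[ℂ] H) z) A := Algebra.commutes z A
  have h1 : algebraMap ℂ (H →L[ℂ] H) (z * z) - A * A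
      = (algebraMap ℂ (H →L[ℂ] H) z - A) * (algebraMap ℂ (H →L[ℂ] H) z + A) := by
    rw [map_mul, sub_mul, mul_add, mul_add, hcomm.eq]
    abel
  have hcomm2 : Commute (algebraMap ℂ (H →L[ℂ] H) z - A) (algebraMap ℂ (H →L[ℂ] H) z + A) :=
    ((Commute.refl _).add_right hcomm).sub_left (hcomm.symm.add_right (Commute.refl _))
  rw [h1, hcomm2.isUnit_mul_iff, ← h.isUnit_sub_iff, and_self]

/-- The operator is the scalar `m - 1` on `ker Q` and `E = m - 1 - k² - k T` on the range of `Q`.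
Since `‖T‖ ≤ 2`, the bound on `m` makes `E` invertible; its inverse commutes with `Q`, so the two
blocks can be inverted separately. -/
theorem isUnit_sub_sq {m : ℝ} (hm : m ≠ 1) (hm' : 2 * (k : ℝ) < |(k : ℝ) ^ 2 + 1 - m|) :
    IsUnit (algebraMap ℂ (H →L[ℂ] H) m - A * A) := by
  set T := F * G + G * F with hT
  set E : H →L[ℂ] H := algebraMap ℂ (H →L[ℂ] H) ((m - 1 - k ^ 2 : ℝ) : ℂ) - (k : ℂ) • T with hE
  have hTnorm : ‖T‖ ≤ 2 := by
    refine ContinuousLinearMap.opNorm_le_bound _ (by norm_num) fun y => ?_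
    refine (norm_add_le (F (G y)) (G (F y))).trans ?_
    rw [h.norm_F, h.norm_G, h.norm_G, h.norm_F]
    linarith
  have hEunit : IsUnit E := by
    by_contra hcon
    have hmem : ((m - 1 - k ^ 2 : ℝ) : ℂ) ∈ spectrum ℂ ((k : ℂ) • T) := hcon
    have hle := spectrum.norm_le_norm_mul_of_mem hmem
    have hone : ‖(1 : H →L[ℂ] H)‖ ≤ 1 := ContinuousLinearMap.norm_id_le
    rw [norm_smul, Complex.norm_natCast, Complex.norm_real, Real.norm_eq_abs] at hle
    have h1 : |m - 1 - (k : ℝ) ^ 2| = |(k : ℝ) ^ 2 + 1 - m| := by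
      rw [← abs_neg]
      congr 1
      ring
    have h2 : (k : ℝ) * ‖T‖ * ‖(1 : H →L[ℂ] H)‖ ≤ k * 2 * 1 := by gcongr
    linarith
  have hQE : Commute Q E :=
    (Algebra.commute_algebraMap_right _ _).sub_right (h.commute_Q_FG.smul_right _)
  obtain ⟨e, he⟩ := hEunit
  have hQe : Commute Q (↑e⁻¹ : H →L[ℂ] H) := by
    rw [← he] at hQE
    exact hQE.units_inv_right
  have hm1 : ((m : ℂ) - 1) ≠ 0 := sub_ne_zero.2 (by exact_mod_cast hm)
  have hdecomp : algebraMap ℂ (H →L[ℂ] H) m - A * A = ((m : ℂ) - 1) • (1 - Q) + Q * E := by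
    rw [h.sq_eq, hE, mul_sub, Algebra.algebraMap_eq_smul_one, Algebra.algebraMap_eq_smul_one,
      mul_add, smul_add, mul_smul_comm, mul_smul_comm, mul_smul_comm, mul_one, smul_smul]
    push_cast
    module
  have hQ1 : Q * (1 - Q) = 0 := by rw [mul_sub, mul_one, h.Q_mul_Q, sub_self]
  have hQ2 : (1 - Q) * Q = 0 := by rw [sub_mul, one_mul, h.Q_mul_Q, sub_self]
  have hQ3 : (1 - Q) * (1 - Q) = 1 - Q := by rw [mul_sub, mul_one, hQ2, sub_zero]
  have hmul : ∀ X Y : H →L[ℂ] H, ∀ a b : ℂ, a * b = 1 → X * Y = 1 → Commute Q X → Commute Q Y →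
      (a • (1 - Q) + Q * X) * (b • (1 - Q) + Q * Y) = 1 := by
    intro X Y a b hab hXY hX hY
    have e1 : (1 - Q) * (Q * Y) = 0 := by rw [← mul_assoc, hQ2, zero_mul]
    have e2 : Q * X * (1 - Q) = 0 := by
      rw [hX.eq, mul_assoc, hQ1, mul_zero]
    have e3 : Q * X * (Q * Y) = Q := by
      rw [hX.eq, mul_assoc, ← mul_assoc Q Q, h.Q_mul_Q, hY.eq, ← mul_assoc, hXY, one_mul]
    rw [add_mul, mul_add, mul_add, smul_mul_smul_comm, hab, hQ3, smul_mul_assoc, e1, mul_smul_comm,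
      e2, e3]
    simp
  rw [hdecomp, ← he]
  exact ⟨⟨_, ((m : ℂ) - 1)⁻¹ • (1 - Q) + Q * ↑e⁻¹,
    hmul _ _ _ _ (mul_inv_cancel₀ hm1) e.mul_inv (he ▸ hQE) hQe,
    hmul _ _ _ _ (inv_mul_cancel₀ hm1) e.inv_mul hQe (he ▸ hQE)⟩, rfl⟩

theorem not_isUnit_one_sub_sq {y : H} (hy : y ≠ 0) (hQy : Q y = 0) :
    ¬ IsUnit (algebraMap ℂ (H →L[ℂ] H) 1 - A * A) := by
  rintro ⟨e, he⟩
  apply hy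
  have h1 : (e : H →L[ℂ] H) y = 0 := by
    rw [he, map_one, sub_apply, one_apply_eq_self, mul_apply_eq_comp, h.sq_apply_of_Q_eq_zero hQy,
      sub_self]
  have h2 : ((↑e⁻¹ * ↑e : H →L[ℂ] H)) y = y := by rw [e.inv_mul, one_apply_eq_self]
  rw [← h2, mul_apply_eq_comp, h1, map_zero]

/-- Approximate eigenvectors `∑_{i < N} w^{N-1-i} D^i y` of the operator `D`. -/
theorem not_isUnit_of_orthogonal {w : ℂ} (hw : ‖w‖ = 1) {y : H} (hy : y ≠ 0)
    (hQy : Q y = y)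
    (horth : ∀ i j : ℕ, i < j → inner ℂ (((F * G) ^ i) y) (((F * G) ^ j) y) = 0) :
    ¬ IsUnit (algebraMap ℂ (H →L[ℂ] H) (k ^ 2 + 1 + k * (w + star w)) - A * A) := by
  rintro ⟨e, he⟩
  have hww : star w * w = 1 := by
    have h1 := Complex.conj_mul' w
    rw [hw] at h1
    simpa using h1
  set D := F * G with hD
  have hDnorm : ∀ z, ‖D z‖ = ‖z‖ := fun z => (h.norm_F (G z)).trans (h.norm_G z)
  have hDpow : ∀ n : ℕ, ‖(D ^ n) y‖ = ‖y‖ := by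
    intro n
    induction n with
    | zero => simp
    | succ n ih => rw [pow_succ', mul_apply_eq_comp, hDnorm, ih]
  have hQD : Commute Q D := Commute.mul_right h.F_mul_Q.symm h.G_mul_Q.symm
  have hQDpow : ∀ n : ℕ, Q ((D ^ n) y) = (D ^ n) y := fun n => by
    have h1 : Q ((D ^ n) y) = (D ^ n) (Q y) :=
      congrArg (fun T : H →L[ℂ] H => T y) (hQD.pow_right n).eq
    rw [h1, hQy]
  let f : ℕ → H := fun n => Nat.rec 0 (fun n v => w • v + (D ^ n) y) n
  have hf0 : f 0 = 0 := rfl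
  have hfs : ∀ n, f (n + 1) = w • f n + (D ^ n) y := fun n => rfl
  have hQf : ∀ n, Q (f n) = f n := by
    intro n
    induction n with
    | zero => rw [hf0, map_zero]
    | succ n ih => rw [hfs, map_add, map_smul, ih, hQDpow]
  -- The sum telescopes: the error stays below `2 ‖y‖`, while by orthogonality `‖f n‖` grows like
  -- `√n`.
  have hDf : ∀ n, D (f n) - w • f n = (D ^ n) y - w ^ n • y := by
    intro n
    induction n with
    | zero => simp [hf0]
    | succ n ih =>
      have h1 : D ((D ^ n) y) = (D ^ (n + 1)) y :=
        (congrArg (fun T : H →L[ℂ] H => T y) (pow_succ' D n)).symm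
      rw [hfs, map_add, map_smul, h1, smul_add, add_sub_add_comm, ← smul_sub, ih, smul_sub,
        smul_smul, ← pow_succ']
      abel
  have hfperp : ∀ n m, n ≤ m → inner ℂ (f n) ((D ^ m) y) = 0 := by
    intro n
    induction n with
    | zero => simp [hf0]
    | succ n ih =>
      intro m hm
      rw [hfs, inner_add_left, inner_smul_left, ih m (by omega), horth n m (by omega), mul_zero,
        add_zero]
  have hfnorm : ∀ n : ℕ, ‖f n‖ ^ 2 = n * ‖y‖ ^ 2 := by
    intro n
    induction n with
    | zero => simp [hf0]
    | succ n ih =>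
      have h1 : inner ℂ (w • f n) ((D ^ n) y) = 0 := by
        rw [inner_smul_left, hfperp n n le_rfl, mul_zero]
      have h2 := norm_add_sq_eq_norm_sq_add_norm_sq_of_inner_eq_zero _ _ h1
      rw [hfs, sq, h2, norm_smul, hw, one_mul, hDpow, ← sq, ih]
      push_cast
      ring
  have hDw : ∀ n, ‖(D ^ n) y - w ^ n • y‖ ≤ 2 * ‖y‖ := by
    intro n
    refine (norm_sub_le _ _).trans ?_
    rw [hDpow, norm_smul, norm_pow, hw, one_pow]
    linarith
  -- `D + D⁻¹ - (w + w⁻¹) = D⁻¹ (D - w⁻¹) (D - w)`, where `w⁻¹ = star w` and `D⁻¹ = GF`.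
  have hfactor : ∀ z, F (G z) + G (F z) - (w + star w) • z
      = G (F (D (D z - w • z) - star w • (D z - w • z))) := by
    intro z
    have h1 : ∀ v, G (F (D v)) = v := fun v => by
      change G (F (F (G v))) = v
      rw [h.F_apply_F, h.G_apply_G]
    have h2 : F (G z) = D z := rfl
    rw [map_sub, map_sub, h1, map_smul, map_smul, map_sub, map_sub, h1, map_smul, map_smul,
      smul_sub, smul_smul, hww, one_smul, h2, add_smul]
    abel
  have he_apply : ∀ n, (e : H →L[ℂ] H) (f n) =
      -((k : ℂ) • (F (G (f n)) + G (F (f n)) - (w + star w) • f n)) := by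
    intro n
    rw [he, sub_apply, mul_apply_eq_comp, h.sq_apply_of_Q_eq_self (hQf n),
      Algebra.algebraMap_eq_smul_one, smul_apply, one_apply_eq_self]
    module
  have hbound : ∀ n, ‖(e : H →L[ℂ] H) (f n)‖ ≤ k * (4 * ‖y‖) := by
    intro n
    rw [he_apply, norm_neg, norm_smul, Complex.norm_natCast, hfactor, hDf, h.norm_G, h.norm_F]
    refine mul_le_mul_of_nonneg_left ?_ (Nat.cast_nonneg k)
    refine (norm_sub_le _ _).trans ?_
    rw [hDnorm, norm_smul, norm_star, hw, one_mul]
    linarith [hDw n]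
  set C : ℝ := ‖(↑e⁻¹ : H →L[ℂ] H)‖ * (k * (4 * ‖y‖)) with hC
  have hfC : ∀ n, ‖f n‖ ≤ C := by
    intro n
    have h2 : ((↑e⁻¹ * ↑e : H →L[ℂ] H)) (f n) = f n := by rw [e.inv_mul, one_apply_eq_self]
    rw [← h2, mul_apply_eq_comp]
    exact (ContinuousLinearMap.le_opNorm _ _).trans
      (mul_le_mul_of_nonneg_left (hbound n) (norm_nonneg _))
  have hypos : 0 < ‖y‖ ^ 2 := by positivity
  obtain ⟨n, hn⟩ := exists_nat_gt (C ^ 2 / ‖y‖ ^ 2)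
  rw [div_lt_iff₀ hypos, ← hfnorm] at hn
  exact absurd (pow_le_pow_left₀ (norm_nonneg _) (hfC n) 2) (not_le.2 hn)

theorem spectrum_eq (hk : 2 ≤ k) {y₀ : H} (hy₀ : y₀ ≠ 0) (hQy₀ : Q y₀ = 0) {y : H} (hy : y ≠ 0)
    (hQy : Q y = y)
    (horth : ∀ i j : ℕ, i < j → inner ℂ (((F * G) ^ i) y) (((F * G) ^ j) y) = 0) :
    spectrum ℂ A = (fun t : ℝ => (t : ℂ)) ''
      ({-1, 1} ∪ Set.Icc ((k : ℝ) - 1) (k + 1) ∪ Set.Icc (-(k : ℝ) - 1) (-k + 1)) := by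
  have hk2 : (2 : ℝ) ≤ k := by exact_mod_cast hk
  -- The bands are `(k - 1)² ≤ t² ≤ (k + 1)²`, a condition on `t²` alone.
  have hset : ∀ t : ℝ,
      t ∈ ({-1, 1} ∪ Set.Icc ((k : ℝ) - 1) (k + 1) ∪ Set.Icc (-(k : ℝ) - 1) (-k + 1)) ↔
        t * t = 1 ∨ |(k : ℝ) ^ 2 + 1 - t * t| ≤ 2 * (k : ℝ) := by
    intro t
    have h1 : t * t = 1 ↔ t = -1 ∨ t = 1 := by rw [mul_self_eq_one_iff, or_comm]
    have h2 : |(k : ℝ) ^ 2 + 1 - t * t| ≤ 2 * (k : ℝ) ↔ (k : ℝ) - 1 ≤ |t| ∧ |t| ≤ k + 1 := by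
      rw [← abs_mul_abs_self t, abs_le]
      have := abs_nonneg t
      constructor
      · rintro ⟨h3, h4⟩
        constructor <;> nlinarith
      · rintro ⟨h3, h4⟩
        constructor <;> nlinarith
    rw [h1, h2]
    simp only [Set.mem_union, Set.mem_insert_iff, Set.mem_singleton_iff, Set.mem_Icc]
    rw [or_assoc]
    refine or_congr Iff.rfl ?_
    rcases abs_cases t with ⟨h3, h4⟩ | ⟨h3, h4⟩ <;> rw [h3] <;> constructor
    · rintro (⟨h5, h6⟩ | ⟨h5, h6⟩) <;> constructor <;> linarith
    · rintro ⟨h5, h6⟩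
      exact Or.inl ⟨h5, h6⟩
    · rintro (⟨h5, h6⟩ | ⟨h5, h6⟩) <;> constructor <;> linarith
    · rintro ⟨h5, h6⟩
      exact Or.inr ⟨by linarith, by linarith⟩
  ext z
  constructor
  · intro hz
    have hre : z = ((z.re : ℝ) : ℂ) := h.isSelfAdjoint.mem_spectrum_eq_re hz
    refine ⟨z.re, ?_, hre.symm⟩
    rw [hset]
    by_contra hcon
    rw [not_or, not_le] at hcon
    rw [h.mem_spectrum_iff, hre, ← Complex.ofReal_mul] at hz
    exact hz (h.isUnit_sub_sq hcon.1 hcon.2)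
  · rintro ⟨t, ht, rfl⟩
    rw [hset] at ht
    change (t : ℂ) ∈ spectrum ℂ A
    rw [h.mem_spectrum_iff, ← Complex.ofReal_mul]
    rcases ht with ht | ht
    · rw [ht, Complex.ofReal_one]
      exact h.not_isUnit_one_sub_sq hy₀ hQy₀
    -- Solve `t² = k² + 1 + 2 k cos θ` for `a = cos θ`, and take `w = exp (i θ)`.
    · set a : ℝ := (t * t - k ^ 2 - 1) / (2 * k) with ha
      have hab : |a| ≤ 1 := by
        rw [ha, abs_div, abs_of_pos (by linarith : (0 : ℝ) < 2 * k), div_le_one (by linarith),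
          ← abs_neg, show -(t * t - (k : ℝ) ^ 2 - 1) = k ^ 2 + 1 - t * t by ring]
        exact ht
      have hcos : Real.cos (Real.arccos a) = a := Real.cos_arccos (abs_le.1 hab).1 (abs_le.1 hab).2
      have hw : ‖Complex.exp (Real.arccos a * Complex.I)‖ = 1 := Complex.norm_exp_ofReal_mul_I _
      have hfin := h.not_isUnit_of_orthogonal hw hy hQy horth
      have hval : ((t * t : ℝ) : ℂ) = k ^ 2 + 1 + k * (Complex.exp (Real.arccos a * Complex.I)
          + star (Complex.exp (Real.arccos a * Complex.I))) := by
        have h3 : Complex.exp (Real.arccos a * Complex.I)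
            + star (Complex.exp (Real.arccos a * Complex.I)) = ((2 * a : ℝ) : ℂ) := by
          have h4 := Complex.add_conj (Complex.exp (Real.arccos a * Complex.I))
          rw [Complex.exp_ofReal_mul_I_re, hcos] at h4
          exact h4
        rw [h3]
        have h5 : t * t = k ^ 2 + 1 + k * (2 * a) := by
          rw [ha]
          field_simp
          ring
        exact_mod_cast h5
      rw [hval]
      exact hfin

end LayerOperators
end LayerOperators

/-! ### Weighted permutation operators on `ℓ²` -/

section MonomialOperators

variable {V : Type*}

theorem lp_add_apply (f g : lp (fun _ : V => ℂ) 2) (v : V) : (f + g) v = f v + g v := rfl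

theorem lp_smul_apply (c : ℂ) (f : lp (fun _ : V => ℂ) 2) (v : V) : (c • f) v = c * f v := rfl

theorem lp_sum_apply {ι : Type*} (s : Finset ι) (f : ι → lp (fun _ : V => ℂ) 2) (v : V) :
    (∑ i ∈ s, f i) v = ∑ i ∈ s, f i v := by
  rw [lp.coeFn_sum]
  exact Finset.sum_apply _ _ _

/-- The isometry `f ↦ s • (f ∘ σ)` of `ℓ²(V)`, for a permutation `σ` and unimodular weights `s`. -/
def monomialIsometry (s : V → ℂ) (hs : ∀ v, ‖s v‖ = 1) (σ : Equiv.Perm V) :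
    lp (fun _ : V => ℂ) 2 →ₗᵢ[ℂ] lp (fun _ : V => ℂ) 2 where
  toFun f := ⟨fun v => s v * f (σ v), by
    have hf := (memℓp_gen_iff (by norm_num)).1 (lp.memℓp f)
    refine (memℓp_gen_iff (by norm_num)).2 ?_
    simpa [hs, Function.comp_def] using (σ.summable_iff (f := fun v => ‖f v‖ ^ (2 : ℝ≥0∞).toReal)).2 hf⟩
  map_add' f g := by
    ext v
    exact mul_add _ _ _
  map_smul' c f := by
    ext v
    exact mul_left_comm _ _ _
  norm_map' f := by
    rw [lp.norm_eq_tsum_rpow (by norm_num), lp.norm_eq_tsum_rpow (by norm_num)]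
    congr 1
    rw [← σ.tsum_eq fun v => ‖f v‖ ^ (2 : ℝ≥0∞).toReal]
    refine tsum_congr fun v => ?_
    change ‖s v * f (σ v)‖ ^ _ = _
    rw [norm_mul, hs, one_mul]

/-- The bounded operator underlying `monomialIsometry`. -/
def monomialOp (s : V → ℂ) (hs : ∀ v, ‖s v‖ = 1) (σ : Equiv.Perm V) :
    lp (fun _ : V => ℂ) 2 →L[ℂ] lp (fun _ : V => ℂ) 2 :=
  (monomialIsometry s hs σ).toContinuousLinearMap

@[simp]
theorem monomialOp_apply (s : V → ℂ) (hs : ∀ v, ‖s v‖ = 1) (σ : Equiv.Perm V)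
    (f : lp (fun _ : V => ℂ) 2) (v : V) : monomialOp s hs σ f v = s v * f (σ v) := rfl

/-- An isometry `T` with `T² = 1` satisfies `⟨T x, y⟩ = ⟨T x, T (T y)⟩ = ⟨x, T y⟩`. -/
theorem monomialOp_isSelfAdjoint {s : V → ℂ} {hs : ∀ v, ‖s v‖ = 1} {σ : Equiv.Perm V}
    (h : monomialOp s hs σ * monomialOp s hs σ = 1) : IsSelfAdjoint (monomialOp s hs σ) := by
  rw [ContinuousLinearMap.isSelfAdjoint_iff_isSymmetric]
  intro x y
  have h1 : monomialOp s hs σ (monomialOp s hs σ y) = y :=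
    congrArg (fun T : lp (fun _ : V => ℂ) 2 →L[ℂ] lp (fun _ : V => ℂ) 2 => T y) h
  have h2 := (monomialIsometry s hs σ).inner_map_map x (monomialOp s hs σ y)
  change inner ℂ (monomialOp s hs σ x) (monomialOp s hs σ (monomialOp s hs σ y)) = _ at h2
  rw [h1] at h2
  exact h2

/-- The permutation operator `f ↦ f ∘ σ`. -/
abbrev permOp (σ : Equiv.Perm V) : lp (fun _ : V => ℂ) 2 →L[ℂ] lp (fun _ : V => ℂ) 2 :=
  monomialOp (fun _ => 1) (fun _ => norm_one) σ

theorem permOp_mul_self {σ : Equiv.Perm V} (h : ∀ v, σ (σ v) = v) :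
    permOp σ * permOp σ = 1 := by
  ext f v
  simp [h]

end MonomialOperators

/-! ### The operators of `Z_k`, its spectrum and its spectral measure -/

section GraphZ

variable {k : ℕ}

/-- The operator exchanging `v_{i,j}` and `w_{i,j}`. -/
def flipOp (k : ℕ) := permOp (V := LayerVertex ℤ k) (Equiv.sumComm _ _)

/-- The permutation exchanging `w_{i,j}` and `v_{i+1,j}`. -/
def linkPerm (k : ℕ) : Equiv.Perm (LayerVertex ℤ k) :=
  Function.Involutive.toPerm
    (Sum.elim (fun p => .inr (p.1 - 1, p.2)) (fun p => .inl (p.1 + 1, p.2)))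
    (by rintro (⟨i, j⟩ | ⟨i, j⟩) <;> simp)

/-- The operator exchanging `w_{i,j}` and `v_{i+1,j}`. -/
def linkOp (k : ℕ) := permOp (linkPerm k)

/-- The permutation `j ↦ m - j` of the second index. -/
def reflectPerm [NeZero k] (m : Fin k) : Equiv.Perm (LayerVertex ℤ k) :=
  Equiv.sumCongr ((Equiv.refl ℤ).prodCongr (Equiv.subLeft m))
    ((Equiv.refl ℤ).prodCongr (Equiv.subLeft m))

/-- The projection averaging over the second index. -/
def meanOp (k : ℕ) [NeZero k] :
    lp (fun _ : LayerVertex ℤ k => ℂ) 2 →L[ℂ] lp (fun _ : LayerVertex ℤ k => ℂ) 2 :=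
  (k : ℂ)⁻¹ • ∑ m : Fin k, permOp (reflectPerm m)

/-- The operator changing the sign on the vertices `w_{i,j}`. -/
def signOp (k : ℕ) := monomialOp (V := LayerVertex ℤ k) (Sum.elim (fun _ => 1) (fun _ => -1))
  (by rintro (v | v) <;> simp) (Equiv.refl _)

variable (f : lp (fun _ : LayerVertex ℤ k => ℂ) 2)

@[simp]
theorem flipOp_inl (p : ℤ × Fin k) : flipOp k f (.inl p) = f (.inr p) := by simp [flipOp]

@[simp]
theorem flipOp_inr (p : ℤ × Fin k) : flipOp k f (.inr p) = f (.inl p) := by simp [flipOp]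

@[simp]
theorem linkOp_inl (i : ℤ) (j : Fin k) : linkOp k f (.inl (i, j)) = f (.inr (i - 1, j)) :=
  one_mul _

@[simp]
theorem linkOp_inr (i : ℤ) (j : Fin k) : linkOp k f (.inr (i, j)) = f (.inl (i + 1, j)) :=
  one_mul _

@[simp]
theorem signOp_inl (p : ℤ × Fin k) : signOp k f (.inl p) = f (.inl p) := by simp [signOp]

@[simp]
theorem signOp_inr (p : ℤ × Fin k) : signOp k f (.inr p) = -f (.inr p) := by simp [signOp]

@[simp]
theorem meanOp_inl [NeZero k] (i : ℤ) (j : Fin k) :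
    meanOp k f (.inl (i, j)) = (k : ℂ)⁻¹ * ∑ l, f (.inl (i, l)) := by
  rw [← Equiv.sum_comp (Equiv.subRight j)]
  rw [meanOp, smul_apply, lp_smul_apply, sum_apply, lp_sum_apply]
  simp [reflectPerm]

@[simp]
theorem meanOp_inr [NeZero k] (i : ℤ) (j : Fin k) :
    meanOp k f (.inr (i, j)) = (k : ℂ)⁻¹ * ∑ l, f (.inr (i, l)) := by
  rw [← Equiv.sum_comp (Equiv.subRight j)]
  rw [meanOp, smul_apply, lp_smul_apply, sum_apply, lp_sum_apply]
  simp [reflectPerm]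

theorem adjZ_apply (x : LayerVertex ℤ k) : adjZ k f x = ∑ y ∈ graphZNeighbors k x, f y := by
  refine Finset.sum_congr ?_ fun _ _ => rfl
  ext y
  rw [mem_graphZNeighbors, SimpleGraph.mem_neighborFinset, SimpleGraph.mem_neighborSet]

@[simp]
theorem adjZ_inl (i : ℤ) (j : Fin k) :
    adjZ k f (.inl (i, j)) = f (.inr (i - 1, j)) + ∑ l, f (.inr (i, l)) := by
  rw [adjZ_apply, graphZNeighbors, Finset.sum_insert (by simp; omega),
    Finset.sum_image (fun a _ b _ hab => by simpa using hab)]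

@[simp]
theorem adjZ_inr (i : ℤ) (j : Fin k) :
    adjZ k f (.inr (i, j)) = f (.inl (i + 1, j)) + ∑ l, f (.inl (i, l)) := by
  rw [adjZ_apply, graphZNeighbors, Finset.sum_insert (by simp),
    Finset.sum_image (fun a _ b _ hab => by simpa using hab)]

theorem signOp_mul_self : signOp k * signOp k = 1 := by
  ext f (v | v) <;> simp

/-- A square-summable function cannot have constant nonzero modulus on infinitely many distinct
vertices. -/
theorem eq_zero_of_norm_shift {c : ℤ → LayerVertex ℤ k} (hc : Function.Injective c)
    (hf : ∀ i, ‖f (c (i + 1))‖ = ‖f (c i)‖) (i : ℤ) : f (c i) = 0 := by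
  have hconst : ∀ n : ℕ, ‖f (c (i + n))‖ = ‖f (c i)‖ := by
    intro n
    induction n with
    | zero => simp
    | succ n ih => rw [← ih, ← hf (i + n), Nat.cast_succ, add_assoc]
  have hsum := (memℓp_gen_iff (by norm_num)).1 (lp.memℓp f)
  have hinj : Function.Injective fun n : ℕ => c (i + n) := fun a b hab => by
    have := hc hab
    omega
  have h1 := hsum.comp_injective hinj
  simp only [Function.comp_def, hconst, summable_const_iff] at h1
  simpa using h1

theorem layerOperators_adjZ [NeZero k] :
    LayerOperators k (adjZ k) (flipOp k) (linkOp k) (meanOp k) (signOp k) := by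
  have hk : (k : ℂ) ≠ 0 := NeZero.ne _
  have hF : flipOp k * flipOp k = 1 := permOp_mul_self (by rintro (v | v) <;> rfl)
  have hG : linkOp k * linkOp k = 1 :=
    permOp_mul_self (Function.Involutive.toPerm_involutive _)
  constructor
  · ext f (⟨i, j⟩ | ⟨i, j⟩) <;>
      simp [add_apply, smul_apply, lp_add_apply, lp_smul_apply, hk, add_comm,
        -lp.coeFn_add, -lp.coeFn_smul]
  · exact hF
  · exact hG
  · ext f (⟨i, j⟩ | ⟨i, j⟩) <;> simp [hk]
  · exact signOp_mul_self
  · ext f (⟨i, j⟩ | ⟨i, j⟩) <;> simp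
  · ext f (⟨i, j⟩ | ⟨i, j⟩) <;> simp
  · ext f (⟨i, j⟩ | ⟨i, j⟩) <;> simp [add_comm]
  · exact monomialOp_isSelfAdjoint hF
  · exact monomialOp_isSelfAdjoint hG
  -- Averaging over reflections `j ↦ m - j` instead of rotations makes every summand an involution,
  -- hence self-adjoint.
  · refine IsSelfAdjoint.smul (by simp [IsSelfAdjoint]) (isSelfAdjoint_sum _ fun m _ => ?_)
    refine monomialOp_isSelfAdjoint (permOp_mul_self ?_)
    rintro (⟨i, j⟩ | ⟨i, j⟩) <;> simp [reflectPerm]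
  · intro y hy
    have hy' : ∀ v, flipOp k (linkOp k y) v = -y v := fun v => by rw [hy]; rfl
    ext (⟨i, j⟩ | ⟨i, j⟩)
    · refine eq_zero_of_norm_shift y (c := fun i => .inl (i, j)) (fun a b hab => by simpa using hab)
        (fun i => ?_) i
      have h1 := hy' (.inl (i, j))
      rw [flipOp_inl, linkOp_inr] at h1
      rw [h1, norm_neg]
    · refine eq_zero_of_norm_shift y (c := fun i => .inr (i, j)) (fun a b hab => by simpa using hab)
        (fun i => ?_) i
      have h1 := hy' (.inr (i + 1, j))
      rw [flipOp_inr, linkOp_inl, add_sub_cancel_right] at h1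
      rw [h1, norm_neg]

/-- The indicator function of the vertices `v_{i,j}`, for fixed `i`. -/
def layerIndicator (k : ℕ) (i : ℤ) : lp (fun _ : LayerVertex ℤ k => ℂ) 2 :=
  ∑ l : Fin k, lp.single 2 (.inl (i, l)) (1 : ℂ)

theorem layerIndicator_inl (i i' : ℤ) (j : Fin k) :
    layerIndicator k i (.inl (i', j)) = if i' = i then 1 else 0 := by
  rw [layerIndicator, lp_sum_apply]
  simp [Pi.single_apply, ite_and]

theorem layerIndicator_inr (i : ℤ) (p : ℤ × Fin k) : layerIndicator k i (.inr p) = 0 := by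
  rw [layerIndicator, lp_sum_apply]
  simp

theorem inner_layerIndicator {i i' : ℤ} (h : i ≠ i') :
    inner ℂ (layerIndicator k i) (layerIndicator k i') = 0 := by
  nth_rewrite 1 [layerIndicator]
  rw [sum_inner]
  refine Finset.sum_eq_zero fun l _ => ?_
  rw [lp.inner_single_left, layerIndicator_inl, if_neg h, inner_zero_right]

/-- `FG` reads a function on the `v_{i,j}` one layer higher, so it moves the indicator one layer
down. Its orbit thus consists of pairwise orthogonal vectors. -/
theorem pow_layerIndicator (n : ℕ) :
    ((flipOp k * linkOp k) ^ n) (layerIndicator k 0) = layerIndicator k (-n) := by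
  induction n with
  | zero => simp
  | succ n ih =>
    rw [pow_succ', mul_apply_eq_comp, ih]
    ext (⟨i, j⟩ | ⟨i, j⟩)
    · simp only [mul_apply_eq_comp, flipOp_inl, linkOp_inr, layerIndicator_inl]
      refine if_congr ?_ rfl rfl
      push_cast
      omega
    · simp [layerIndicator_inr]

theorem spectrum_adjZ (hk : 2 ≤ k) :
    spectrum ℂ (adjZ k) = (fun t : ℝ => (t : ℂ)) ''
      ({-1, 1} ∪ Set.Icc ((k : ℝ) - 1) (k + 1) ∪ Set.Icc (-(k : ℝ) - 1) (-k + 1)) := by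
  have : NeZero k := ⟨by omega⟩
  have hkc : (k : ℂ) ≠ 0 := NeZero.ne _
  let a : Fin k := ⟨0, by omega⟩
  let b : Fin k := ⟨1, by omega⟩
  -- A difference of two point masses in one layer has mean zero; it exists because `k ≥ 2`. A layer
  -- indicator is fixed by the averaging.
  refine layerOperators_adjZ.spectrum_eq hk
    (y₀ := lp.single 2 (.inl (0, a)) 1 - lp.single 2 (.inl (0, b)) 1) ?_ ?_
    (y := layerIndicator k 0) ?_ ?_ ?_
  · intro h
    have h1 := congrArg (fun f : lp (fun _ : LayerVertex ℤ k => ℂ) 2 => f (.inl (0, a))) h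
    simp [a, b] at h1
  · ext (⟨i, j⟩ | ⟨i, j⟩)
    · simp [Pi.single_apply, ite_and]
    · simp
  · intro h
    have h1 := congrArg (fun f : lp (fun _ : LayerVertex ℤ k => ℂ) 2 => f (.inl (0, a))) h
    simp [layerIndicator_inl] at h1
  · ext (⟨i, j⟩ | ⟨i, j⟩)
    · simp [layerIndicator_inl, hkc]
    · simp [layerIndicator_inr]
  · intro i j hij
    rw [pow_layerIndicator, pow_layerIndicator]
    exact inner_layerIndicator (by omega)

/-- `⟨δ_v, Q δ_v⟩ = 1/k`, and `A (δ_v - Q δ_v)` vanishes at `v` because `A` exchanges the two sides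
of the bipartition while `Q` preserves them. -/
theorem spectralMeasureZ_singleton (hk : 2 ≤ k) {c : ℝ} (hc : c * c = 1) (v : LayerVertex ℤ k) :
    spectralMeasureZ k v {c} = ENNReal.ofReal (1 / 2 - 1 / (2 * k)) := by
  have : NeZero k := ⟨by omega⟩
  refine layerOperators_adjZ.spectralMeasure_singleton_eq hk hc ?_ ?_ ?_
  · simp
  · rw [lp.inner_single_left]
    rcases v with ⟨i, j⟩ | ⟨i, j⟩ <;> simp [Pi.single_apply]
  · rw [lp.inner_single_left]
    rcases v with ⟨i, j⟩ | ⟨i, j⟩ <;> simp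

theorem spectralMeasureZ_map_neg [NeZero k] (v : LayerVertex ℤ k) :
    (spectralMeasureZ k v).map (fun t => -t) = spectralMeasureZ k v := by
  have h := layerOperators_adjZ (k := k)
  have hU : IsSelfAdjoint (signOp k) := monomialOp_isSelfAdjoint signOp_mul_self
  rcases v with p | p
  · refine spectralMeasure_map_neg h.isSelfAdjoint hU h.U_mul_U h.U_mul_A_mul_U (ε := 1) ?_ (by simp)
    ext (q | q) <;> simp
  · refine spectralMeasure_map_neg h.isSelfAdjoint hU h.U_mul_U h.U_mul_A_mul_U (ε := -1) ?_
      (by simp)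
    ext (q | q) <;> simp

/-- The total mass is `1`, the atoms at `±1` take `1 - 1/k` together, and the rest is shared equally
by two sets that `t ↦ -t` exchanges. -/
theorem spectralMeasureZ_Icc (hk : 2 ≤ k) (v : LayerVertex ℤ k) :
    spectralMeasureZ k v (Set.Icc ((k : ℝ) - 1) (k + 1) \ {1}) = ENNReal.ofReal (1 / (2 * k)) ∧
      spectralMeasureZ k v (Set.Icc (-(k : ℝ) - 1) (-k + 1) \ {-1}) =
        ENNReal.ofReal (1 / (2 * k)) := by
  have : NeZero k := ⟨by omega⟩
  have hk2 : (2 : ℝ) ≤ k := by exact_mod_cast hk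
  set μ := spectralMeasureZ k v with hμ
  have hfin : MeasureTheory.IsFiniteMeasure μ := spectralMeasure_isFiniteMeasure _ _
  set P := Set.Icc ((k : ℝ) - 1) (k + 1) \ {1} with hP
  set N := Set.Icc (-(k : ℝ) - 1) (-k + 1) \ {-1} with hN
  have hPm : MeasurableSet P := measurableSet_Icc.diff (measurableSet_singleton _)
  have hNm : MeasurableSet N := measurableSet_Icc.diff (measurableSet_singleton _)
  have hNP : μ N = μ P := by
    have h1 : μ.map (fun t => -t) = μ := spectralMeasureZ_map_neg v
    rw [← h1, MeasureTheory.Measure.map_apply measurable_neg hNm, h1]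
    congr 1
    ext t
    simp only [hN, hP, Set.mem_preimage, Set.mem_sdiff, Set.mem_Icc, Set.mem_singleton_iff, neg_inj]
    constructor <;> rintro ⟨⟨h2, h3⟩, h4⟩ <;> exact ⟨⟨by linarith, by linarith⟩, h4⟩
  have hsupp : μ ((P ∪ N) ∪ ({1} ∪ {-1}))ᶜ = 0 := by
    refine MeasureTheory.measure_mono_null ?_ (spectralMeasure_compl_spectrum (adjZ k) _)
    refine Set.compl_subset_compl.2 fun t ht => ?_
    have ht' : (t : ℂ) ∈ spectrum ℂ (adjZ k) := by
      rw [← spectrum.algebraMap_mem_iff ℂ] at ht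
      exact ht
    rw [spectrum_adjZ hk] at ht'
    obtain ⟨t', h1, h2⟩ := ht'
    rw [Complex.ofReal_injective h2] at h1
    simp only [hP, hN, Set.mem_union, Set.mem_sdiff, Set.mem_singleton_iff,
      Set.mem_insert_iff] at h1 ⊢
    tauto
  have htotal : μ Set.univ = 1 := by
    rw [hμ, spectralMeasureZ, spectralMeasure_univ layerOperators_adjZ.isSelfAdjoint,
      lp.norm_single (by norm_num)]
    simp
  have hdisj1 : Disjoint P N := by
    rw [Set.disjoint_left]
    rintro t ⟨h1, -⟩ ⟨h2, -⟩
    linarith [h1.1, h2.2]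
  have hdisj2 : Disjoint ({1} : Set ℝ) {-1} := by
    rw [Set.disjoint_singleton]
    norm_num
  have hdisj3 : Disjoint (P ∪ N) ({1} ∪ {-1} : Set ℝ) := by
    rw [Set.disjoint_left]
    rintro t (⟨h1, h2⟩ | ⟨h1, h2⟩) (h3 | h3)
    · exact h2 h3
    · rw [Set.mem_singleton_iff] at h3
      linarith [h1.1]
    · rw [Set.mem_singleton_iff] at h3
      linarith [h1.2]
    · exact h2 h3
  have hm12 : MeasurableSet ({1} ∪ {-1} : Set ℝ) :=
    (measurableSet_singleton _).union (measurableSet_singleton _)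
  have hsum : μ.real P + μ.real N + (μ.real {1} + μ.real {-1}) = 1 := by
    rw [← MeasureTheory.measureReal_union hdisj1 hNm,
      ← MeasureTheory.measureReal_union hdisj2 (measurableSet_singleton _),
      ← MeasureTheory.measureReal_union hdisj3 hm12]
    have h1 := MeasureTheory.measureReal_add_measureReal_compl (μ := μ) ((hPm.union hNm).union hm12)
    rw [MeasureTheory.measureReal_def μ _ᶜ, hsupp, MeasureTheory.measureReal_def μ Set.univ,
      htotal] at h1
    simpa using h1
  -- Without this, `ENNReal.ofReal` might truncate the mass of the atoms to zero.
  have hnn : (0 : ℝ) ≤ 1 / 2 - 1 / (2 * k) := by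
    rw [sub_nonneg]
    exact one_div_le_one_div_of_le (by norm_num) (by linarith)
  have hatom : ∀ c : ℝ, c * c = 1 → μ.real {c} = 1 / 2 - 1 / (2 * k) := fun c hc => by
    rw [MeasureTheory.measureReal_def, hμ, spectralMeasureZ_singleton hk hc,
      ENNReal.toReal_ofReal hnn]
  have hNP' : μ.real N = μ.real P := by
    rw [MeasureTheory.measureReal_def, hNP, MeasureTheory.measureReal_def]
  rw [hatom 1 (by norm_num), hatom (-1) (by norm_num), hNP'] at hsum
  have hPval : μ P = ENNReal.ofReal (1 / (2 * k)) := by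
    rw [← MeasureTheory.ofReal_measureReal]
    congr 1
    linarith
  exact ⟨hPval, hNP.trans hPval⟩

end GraphZ
end

theorem mainTheorem4 (k : ℕ) (hk : 2 ≤ k) :
    -- `Z_k` is an infinite vertex-transitive `(k+1)`-regular graph, the limit of the `W_{n,k}`
    Infinite (LayerVertex ℤ k) ∧
    (graphZ k).IsVertexTransitive ∧
    (graphZ k).IsRegularOfDegree (k + 1) ∧
    SimpleGraph.IsLocalLimit (fun n => graphW n k) (graphZ k) ∧
    -- its spectrum
    IsSelfAdjoint (adjZ k) ∧
    spectrum ℂ (adjZ k) =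
      (fun t : ℝ => (t : ℂ)) ''
        ({-1, 1} ∪ Set.Icc ((k : ℝ) - 1) (k + 1) ∪ Set.Icc (-(k : ℝ) - 1) (-k + 1)) ∧
    -- its spectral measure, at any vertex; for `k = 2` the points `±1` are end points of the
    -- intervals, and their mass is not counted in that of the intervals
    ∀ v : LayerVertex ℤ k,
      spectralMeasureZ k v (Set.Icc ((k : ℝ) - 1) (k + 1) \ {1}) =
        ENNReal.ofReal (1 / (2 * k)) ∧
      spectralMeasureZ k v (Set.Icc (-(k : ℝ) - 1) (-k + 1) \ {-1}) =
        ENNReal.ofReal (1 / (2 * k)) ∧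
      spectralMeasureZ k v {1} = ENNReal.ofReal (1 / 2 - 1 / (2 * k)) ∧
      spectralMeasureZ k v {-1} = ENNReal.ofReal (1 / 2 - 1 / (2 * k)) := by
  have : NeZero k := ⟨by omega⟩
  refine ⟨inferInstance, layerGraph_isVertexTransitive ℤ k, graphZ_degree k, isLocalLimit_graphW k,
    layerOperators_adjZ.isSelfAdjoint, spectrum_adjZ hk, fun v => ?_⟩
  obtain ⟨h1, h2⟩ := spectralMeasureZ_Icc hk v
  exact ⟨h1, h2, spectralMeasureZ_singleton hk (by norm_num) v,
    spectralMeasureZ_singleton hk (by norm_num) v⟩
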